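/- Let $p$ be an odd prime and let $m,k,s$ be positive integers with $k,s\le\lfloor m/2\rfloor$ such that $m/\gcd(m,k)$ and $m/\gcd(m,s)$ are odd. Let $0\le r,t\le\lfloor m/2\rfloor$, and let $\sigma,\tau$ be the automorphisms $\sigma(x)=x^{p^r}$, $\tau(x)=x^{p^t}$ of $\mathbb{F}_{p^m}$. Let $\alpha,\beta\in\mathbb{F}_{p^m}$ be non-squares (possibly equal). Write $x\circ_k y=x^{p^k}y+y^{p^k}x$, and identify $\mathbb{F}_{p^{2m}}$ with $\mathbb{F}_{p^m}^2$. Let $\mathbb{P}_{k,\sigma}$ be the presemifield with the multiplication $$(a,b)*(c,d)=\bigl(a\circ_k c+\alpha\,\sigma(b\circ_k d),\ ad+bc\bigr),$$ and let $\mathbb{P}_{s,\tau}$ be the presemifield with the multiplication $$(a,b)\star(c,d)=\bigl(a\circ_s c+\beta\,\tau(b\circ_s d),\ ad+bc\bigr).$$ If $(k,\sigma)\neq(s,\tau)$, then $\mathbb{P}_{k,\sigma}$ and $\mathbb{P}_{s,\tau}$ are not strongly isotopic, that is, there are no bijective $\mathbb{F}_p$-linear maps $N,L$ of $\mathbb{F}_{p^m}^2$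 with $N(x)\star N(y)=L(x*y)$ for all $x,y$. Equivalently, the corresponding planar functions $f(x)=x*x$ and $g(x)=x\star x$ are not linearly equivalent, that is, there are no bijective $\mathbb{F}_p$-linear maps $l_1,l_2$ of $\mathbb{F}_{p^m}^2$ with $g=l_1\circ f\circ l_2$. -/

import Mathlib

namespace TwoParam

/-- The product `x ∘ₖ y = x^(p^k) y + y^(p^k) x` on a field of characteristic `p`. -/
def circ {K : Type*} [Field K] (p k : ℕ) (x y : K) : K :=
  x ^ p ^ k * y + y ^ p ^ k * x

/-- The multiplication
`(a,b) * (c,d) = (a ∘ₖ c + α σ(b ∘ₖ d), ad + bc)` of the presemifield `P_{k,σ}`, on `K × K`. -/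
def pmul {K : Type*} [Field K] (p k : ℕ) (σ : K ≃+* K) (α : K) (u v : K × K) : K × K :=
  (circ p k u.1 v.1 + α * σ (circ p k u.2 v.2), u.1 * v.2 + u.2 * v.1)

/-- Two multiplications `mul₁`, `mul₂` on the same `F_p`-vector space `V` are strongly isotopic:
there is an isotopism `(N, N, L)`, with `N` and `L` bijective and `F_p`-linear. -/
def StronglyIsotopic (p : ℕ) {V : Type*} [AddCommGroup V] [Module (ZMod p) V]
    (mul₁ mul₂ : V → V → V) : Prop :=
  ∃ N L : V ≃ₗ[ZMod p] V, ∀ x y : V, mul₂ (N x) (N y) = L (mul₁ x y)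

/-- The function `x ↦ x * x` corresponding to a multiplication. -/
def squareMap {V : Type*} (mul : V → V → V) (x : V) : V := mul x x

/-- `f` and `g` are linearly equivalent: `g = l₁ ∘ f ∘ l₂` with `l₁`, `l₂` bijective and
`F_p`-linear. -/
def LinearlyEquivalent (p : ℕ) {V : Type*} [AddCommGroup V] [Module (ZMod p) V]
    (f g : V → V) : Prop :=
  ∃ l₁ l₂ : V ≃ₗ[ZMod p] V, g = l₁ ∘ f ∘ l₂

end TwoParam

/-!
# Non-isotopism of the presemifields `P_{k,σ}`

Let `N = (A, B; C, D)` and `L` be the blocks of a strong isotopism; a linear equivalence of the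
square maps gives one by polarization (`LinearlyEquivalent.stronglyIsotopic`). By Dedekind's theorem
every block is a unique linearized polynomial `∑ aᵢ x^(p^i)`, `i ∈ ZMod m`
(`exists_frobenius_family`), and the coefficients of a bilinear expression in the products
`x^(p^i) y^(p^j)` are unique too (`bilinPoly_injective`). So the isotopism identity is a system of
equations between coefficient tables indexed by `ZMod m × ZMod m`.

A map applied to `x ∘ₖ y` only produces index pairs at distance `k`, and a map applied to `x y` only
diagonal pairs. In the second component this makes every index of `A` lie at distance `k` from every
index of `C`, likewise for `B` and `D`, and makes `A` and `D` share a single index, likewise `B` and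
`C`, unless one of the two vanishes. Since `N` is invertible, at least two blocks are therefore
one-term, and the first component shows that the remaining ones have at most one term
(`exists_subMonomial`). If all four blocks are nonzero, the first component is contradictory
(`Monomial.add_twist_ne_zero`, `Monomial.cross_ne_zero`). Otherwise the distances in the first
component give `s = ±k`, and the positions of the single terms give `t = ±r`
(`params_eq_of_coeff`). The oddness of `m / gcd(m, k)` enters through `4 k ≠ 0` in `ZMod m`, and the
signs are settled by the bound `m / 2` on the parameters (`eq_of_natCast_eq_neg`).
-/

namespace TwoParam

/-! ### Coefficient tables and one-term supports -/

section Coefficients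

variable {m : ℕ} {K : Type*} [Field K] (Φ : ZMod m → K →+* K)

/-- With `Φ i` in the role of the `i`-th Frobenius power, the coefficient of `Φ i x * Φ j y` in
`A x ∘ₛ B y`, where `A = ∑ aᵢ Φ i` and `B = ∑ bᵢ Φ i` (`map_mul_add_map_mul_linPoly`). -/
def circCoeff (s : ZMod m) (a b : ZMod m → K) (i j : ZMod m) : K :=
  Φ s (a (i - s)) * b j + a i * Φ s (b (j - s))

/-- The coefficient of `Φ i x * Φ j y` in `L (x ∘ₖ y)`, where `L = ∑ lᵢ Φ i` (`linPoly_circ`).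
It is supported on the pairs with `i - j = ±k`. -/
def linkCoeff (k : ZMod m) (l : ZMod m → K) (i j : ZMod m) : K :=
  (if i = j + k then l j else 0) + if j = i + k then l i else 0

/-- The effect of `Φ t` on the coefficients of a bilinear expression in the `Φ i x * Φ j y`
(`map_bilinPoly`). -/
def twist (t : ZMod m) (q : ZMod m → ZMod m → K) (i j : ZMod m) : K :=
  Φ t (q (i - t) (j - t))

/-- The linearized polynomial with coefficients `a` has no term other than the `i`-th; it may be
zero. -/
def SubMonomial (a : ZMod m → K) (i : ZMod m) : Prop := ∀ n, a n ≠ 0 → n = i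

/-- The linearized polynomial with coefficients `a` has the `i`-th term and no other. -/
def Monomial (a : ZMod m → K) (i : ZMod m) : Prop := ∀ n, a n ≠ 0 ↔ n = i

variable {Φ}

theorem Monomial.sub {a : ZMod m → K} {i : ZMod m} (h : Monomial a i) : SubMonomial a i :=
  fun n hn => (h n).1 hn

/-- The entries at `(n + s, n)` carry all the information about `A x ∘ₛ A y` for a one-term `A`:
as a function of `n` they are again supported at the index of `A`, see `Monomial.step`. -/
theorem circCoeff_step {s : ZMod m} (a : ZMod m → K) (n : ZMod m) :
    circCoeff Φ s a a (n + s) n = Φ s (a n) * a n + a (n + s) * Φ s (a (n - s)) := by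
  simp [circCoeff]

theorem SubMonomial.circCoeff_step {s : ZMod m} (hs : 2 * s ≠ 0) {a : ZMod m → K} {i : ZMod m}
    (h : SubMonomial a i) (n : ZMod m) :
    circCoeff Φ s a a (n + s) n = Φ s (a n) * a n := by
  rw [TwoParam.circCoeff_step, add_eq_left, mul_eq_zero, map_eq_zero]
  by_contra! hc
  exact hs (by linear_combination h _ hc.1 - h _ hc.2)

theorem SubMonomial.step {s : ZMod m} (hs : 2 * s ≠ 0) {a : ZMod m → K} {i : ZMod m}
    (h : SubMonomial a i) : SubMonomial (fun n => circCoeff Φ s a a (n + s) n) i := by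
  intro n hn
  beta_reduce at hn
  rw [h.circCoeff_step hs] at hn
  exact h n (right_ne_zero_of_mul hn)

theorem Monomial.step {s : ZMod m} (hs : 2 * s ≠ 0) {a : ZMod m → K} {i : ZMod m}
    (h : Monomial a i) : Monomial (fun n => circCoeff Φ s a a (n + s) n) i := by
  intro n
  simp only [h.sub.circCoeff_step hs]
  simp [← h n]

theorem SubMonomial.shift {e : K} {t : ZMod m} {f : ZMod m → K} {i : ZMod m}
    (h : SubMonomial f i) : SubMonomial (fun n => e * Φ t (f (n - t))) (i + t) := by
  intro n hn
  have := h (n - t) (by simpa using right_ne_zero_of_mul hn)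
  linear_combination this

theorem Monomial.shift {e : K} (he : e ≠ 0) {t : ZMod m} {f : ZMod m → K} {i : ZMod m}
    (h : Monomial f i) : Monomial (fun n => e * Φ t (f (n - t))) (i + t) := by
  intro n
  simp [he, ← sub_eq_iff_eq_add, ← h (n - t)]

/-- A one-term polynomial plus a polynomial with at most one term can be a one-term polynomial only
if the two full ones sit at the same index. -/
theorem SubMonomial.eq_of_add {f g h : ZMod m → K} {i j n : ZMod m} (hf : SubMonomial f i)
    (hg : Monomial g j) (hh : Monomial h n) (H : ∀ u, f u + g u = h u) : j = n := by
  by_contra hne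
  have h1 : f j ≠ 0 := fun h0 => by
    have h2 := H j
    rw [h0, zero_add] at h2
    exact hne ((hh j).1 (h2 ▸ (hg j).2 rfl))
  have h2 : f n ≠ 0 := fun h0 => by
    have h2 := H n
    rw [h0, zero_add] at h2
    exact hne ((hg n).1 (h2 ▸ (hh n).2 rfl)).symm
  exact hne ((hf j h1).trans (hf n h2).symm)

theorem SubMonomial.circCoeff_eq_zero {s : ZMod m} {a : ZMod m → K} {i u v : ZMod m}
    (h : SubMonomial a i) (h1 : u ≠ v + s) (h2 : v ≠ u + s) : circCoeff Φ s a a u v = 0 := by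
  have h3 : Φ s (a (u - s)) * a v = 0 := by
    rw [mul_eq_zero, map_eq_zero]
    by_contra! hc
    exact h1 (by linear_combination h _ hc.1 - h _ hc.2)
  have h4 : a u * Φ s (a (v - s)) = 0 := by
    rw [mul_eq_zero, map_eq_zero]
    by_contra! hc
    exact h2 (by linear_combination h _ hc.2 - h _ hc.1)
  rw [circCoeff, h3, h4, add_zero]

theorem linkCoeff_eq_zero {k : ZMod m} {l : ZMod m → K} {u v : ZMod m}
    (h1 : u ≠ v + k) (h2 : v ≠ u + k) : linkCoeff k l u v = 0 := by
  simp [linkCoeff, h1, h2]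

theorem linkCoeff_step {k : ZMod m} (hk : 2 * k ≠ 0) (l : ZMod m → K) (n : ZMod m) :
    linkCoeff k l (n + k) n = l n := by
  have : n ≠ n + k + k := fun h => hk (by linear_combination -h)
  simp [linkCoeff, this]

/-- If `B` has terms only at `i + k` and `i - k`, and `B x ∘ₖ B y` involves only pairs at distance
`k`, then `B` has at most one term: the product of the two coefficients would appear at
`(i + 2k, i - k)`, a pair at distance `3k`. -/
theorem exists_subMonomial {k : ZMod m} (h2 : (2 : K) ≠ 0) (hk2 : 2 * k ≠ 0) (hk4 : 4 * k ≠ 0)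
    {b : ZMod m → K} {i : ZMod m} (hb : ∀ n, b n ≠ 0 → n = i + k ∨ i = n + k)
    (h : ∀ u v, u ≠ v + k → v ≠ u + k → circCoeff Φ k b b u v = 0) :
    ∃ j, SubMonomial b j := by
  have h0 : circCoeff Φ k b b (i + 2 * k) (i - k) = 0 :=
    h _ _ (fun e => hk2 (by linear_combination e)) (fun e => hk4 (by linear_combination -e))
  have hprod : b (i + k) = 0 ∨ b (i - k) = 0 := by
    by_contra! hc
    have e1 : i + 2 * k - k = i + k := by ring
    have e2 : i - k - k = i - 2 * k := by ring
    rw [circCoeff, e1, e2] at h0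
    by_cases h3 : b (i + 2 * k) = 0
    · rw [h3, zero_mul, add_zero, mul_eq_zero, map_eq_zero] at h0
      exact h0.elim hc.1 hc.2
    · -- here `3 * k = 0`, and both summands coincide
      have h3k : 3 * k = 0 := by
        rcases hb _ h3 with h | h
        · exact absurd (by linear_combination 2 * h) hk2
        · linear_combination -h
      have e3 : i + 2 * k = i - k := by linear_combination h3k
      have e4 : i - 2 * k = i + k := by linear_combination -h3k
      rw [e3, e4, mul_comm (b (i - k)), ← two_mul] at h0
      simp [h2, hc.1, hc.2] at h0
  rcases hprod with h | h
  · refine ⟨i - k, fun n hn => ?_⟩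
    rcases hb n hn with rfl | h'
    · exact absurd h hn
    · linear_combination -h'
  · refine ⟨i + k, fun n hn => ?_⟩
    rcases hb n hn with h' | h'
    · exact h'
    · rw [show i - k = n by linear_combination h'] at h
      exact absurd h hn

/-- If `A x * C y + C x * A y = L (x ∘ₖ y)`, then every index of `A` is at distance exactly `k` from
every index of `C`; in particular their supports are disjoint. -/
theorem adjacent_of_orthogonal {k : ZMod m} (h2 : (2 : K) ≠ 0) (hk2 : 2 * k ≠ 0)
    {a c l : ZMod m → K} (h : ∀ i j, a i * c j + c i * a j = linkCoeff k l i j)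
    {i j : ZMod m} (ha : a i ≠ 0) (hc : c j ≠ 0) : j = i + k ∨ i = j + k := by
  have hk : k ≠ 0 := by rintro rfl; simp at hk2
  have hdiag (n : ZMod m) : a n * c n = 0 := by
    have := h n n
    rw [linkCoeff_eq_zero (by simpa using hk) (by simpa using hk), mul_comm (c n), ← two_mul] at this
    exact (mul_eq_zero.1 this).resolve_left h2
  have hci : c i = 0 := (mul_eq_zero.1 (hdiag i)).resolve_left ha
  by_contra! hne
  have := h i j
  rw [linkCoeff_eq_zero hne.2 hne.1, hci, zero_mul, add_zero] at this
  exact (mul_ne_zero ha hc) this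

theorem exists_monomial {a d : ZMod m → K} (ha : a ≠ 0) (hd : d ≠ 0)
    (h : ∀ i j, a i ≠ 0 → d j ≠ 0 → i = j) : ∃ i, Monomial a i ∧ Monomial d i := by
  obtain ⟨i, hi⟩ := Function.ne_iff.1 ha
  obtain ⟨j, hj⟩ := Function.ne_iff.1 hd
  obtain rfl := h i j hi hj
  exact ⟨i, fun n => ⟨fun hn => h _ _ hn hj, fun e => e ▸ hi⟩,
    fun n => ⟨fun hn => (h _ _ hi hn).symm, fun e => e ▸ hj⟩⟩

end Coefficients

/-! ### The coefficient equations force equal parameters -/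

section Core

variable {m : ℕ} {K : Type*} [Field K] {Φ : ZMod m → K →+* K}

theorem Monomial.scale {e l : ZMod m → K} (he : ∀ n, e n ≠ 0) {r i : ZMod m}
    (h : Monomial l i) : Monomial (fun n => e n * l (n - r)) (i + r) := by
  intro n
  simp [he, ← sub_eq_iff_eq_add, ← h (n - r)]

theorem Monomial.of_scale {e l : ZMod m → K} (he : ∀ n, e n ≠ 0) {r i : ZMod m}
    (h : Monomial (fun n => e n * l (n - r)) i) : Monomial l (i - r) := by
  intro n
  have := h (n + r)
  simp only [add_sub_cancel_right, mul_ne_zero_iff, he, ne_eq, not_false_eq_true, true_and] at this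
  rw [ne_eq, this, eq_sub_iff_add_eq]

/-- The first-component equation, read along the entries `(n + s, n)`. -/
theorem step_add_twist_step {k s t : ZMod m} {β : K} {a c l : ZMod m → K}
    (F : ∀ u v, circCoeff Φ s a a u v + β * twist Φ t (circCoeff Φ s c c) u v
      = linkCoeff k l u v) (n : ZMod m) :
    circCoeff Φ s a a (n + s) n + β * Φ t (circCoeff Φ s c c (n - t + s) (n - t))
      = linkCoeff k l (n + s) n := by
  rw [← F, twist, show n + s - t = n - t + s by ring]

/-- If the equation `A x ∘ₛ A y = L (x ∘ₖ y)` has a nonzero left side, then the distances `s` and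
`k` agree up to sign. -/
theorem param_eq_of_left {k s t : ZMod m} {β : K} {a l : ZMod m → K} {i : ZMod m}
    (hs2 : 2 * s ≠ 0) (ha : Monomial a i)
    (F : ∀ u v, circCoeff Φ s a a u v + β * twist Φ t (circCoeff Φ s 0 0) u v
      = linkCoeff k l u v) : k = s ∨ k = -s := by
  by_contra! hne
  have h := F (i + s) i
  rw [linkCoeff_eq_zero (fun e => hne.1 (by linear_combination -e))
    (fun e => hne.2 (by linear_combination -e))] at h
  refine (ha.step (Φ := Φ) hs2 i).2 rfl ?_
  simpa [twist, circCoeff] using h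

theorem param_eq_of_right {k s t : ZMod m} {β : K} (hβ : β ≠ 0) {c l : ZMod m → K} {i : ZMod m}
    (hs2 : 2 * s ≠ 0) (hc : Monomial c i)
    (F : ∀ u v, circCoeff Φ s 0 0 u v + β * twist Φ t (circCoeff Φ s c c) u v
      = linkCoeff k l u v) : k = s ∨ k = -s := by
  by_contra! hne
  have h := step_add_twist_step F (i + t)
  rw [linkCoeff_eq_zero (fun e => hne.1 (by linear_combination -e))
    (fun e => hne.2 (by linear_combination -e))] at h
  refine (hc.step (Φ := Φ) hs2 i).2 rfl ((map_eq_zero (Φ t)).1 ?_)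
  simpa [circCoeff, hβ] using h

theorem twist_circCoeff_eq_zero {k t : ZMod m} {a : ZMod m → K} {i u v : ZMod m}
    (h : SubMonomial a i) (h1 : u ≠ v + k) (h2 : v ≠ u + k) :
    twist Φ t (circCoeff Φ k a a) u v = 0 := by
  rw [twist, h.circCoeff_eq_zero (fun e => h1 (by linear_combination e))
    (fun e => h2 (by linear_combination e)), map_zero]

theorem exists_subMonomial_left {k t : ZMod m} (h2 : (2 : K) ≠ 0) (hk2 : 2 * k ≠ 0)
    (hk4 : 4 * k ≠ 0) {β : K} {b d l : ZMod m → K} {i : ZMod m}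
    (hb : ∀ n, b n ≠ 0 → n = i + k ∨ i = n + k) (hd : SubMonomial d i)
    (F : ∀ u v, circCoeff Φ k b b u v + β * twist Φ t (circCoeff Φ k d d) u v
      = linkCoeff k l u v) : ∃ j, SubMonomial b j := by
  refine exists_subMonomial (Φ := Φ) h2 hk2 hk4 hb fun u v h3 h4 => ?_
  have := F u v
  rwa [linkCoeff_eq_zero h3 h4, twist_circCoeff_eq_zero hd h3 h4, mul_zero, add_zero] at this

theorem exists_subMonomial_right {k t : ZMod m} (h2 : (2 : K) ≠ 0) (hk2 : 2 * k ≠ 0)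
    (hk4 : 4 * k ≠ 0) {β : K} (hβ : β ≠ 0) {a c l : ZMod m → K} {i : ZMod m}
    (hc : ∀ n, c n ≠ 0 → n = i + k ∨ i = n + k) (ha : SubMonomial a i)
    (F : ∀ u v, circCoeff Φ k a a u v + β * twist Φ t (circCoeff Φ k c c) u v
      = linkCoeff k l u v) : ∃ j, SubMonomial c j := by
  refine exists_subMonomial (Φ := Φ) h2 hk2 hk4 hc fun u v h3 h4 => ?_
  have := F (u + t) (v + t)
  rw [linkCoeff_eq_zero (fun e => h3 (by linear_combination e))
    (fun e => h4 (by linear_combination e)), ha.circCoeff_eq_zero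
    (fun e => h3 (by linear_combination e)) (fun e => h4 (by linear_combination e))] at this
  simpa [twist, hβ] using this

/-- When all four blocks are one-term, the left sides of both diagonal equations cannot cancel: that
would force `i = j + t` and `j = i + t`, so `2 (i - j) = 0`, against `i - j = ±k`. -/
theorem Monomial.add_twist_ne_zero {k s t : ZMod m} (hk2 : 2 * k ≠ 0) (hs2 : 2 * s ≠ 0) {β : K}
    (hβ : β ≠ 0) {a b c d : ZMod m → K} {i j : ZMod m} (ha : Monomial a i) (hd : Monomial d i)
    (hb : Monomial b j) (hc : Monomial c j) (hij : j = i + k ∨ i = j + k)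
    (H1 : ∀ n, circCoeff Φ s a a (n + s) n
      + β * Φ t (circCoeff Φ s c c (n - t + s) (n - t)) = 0)
    (H2 : ∀ n, circCoeff Φ s b b (n + s) n
      + β * Φ t (circCoeff Φ s d d (n - t + s) (n - t)) = 0) : False := by
  have key {f g : ZMod m → K} {u v : ZMod m} (hf : Monomial f u) (hg : Monomial g v)
      (H : ∀ n, f n + g n = 0) : u = v := by
    refine (hg u).1 fun h0 => (hf u).2 rfl ?_
    simpa [h0] using H u
  have h1 := key (ha.step hs2) ((hc.step hs2).shift hβ) H1
  have h2 := key (hb.step hs2) ((hd.step hs2).shift hβ) H2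
  rcases hij with h | h
  · exact hk2 (by linear_combination -2 * h + h2 - h1)
  · exact hk2 (by linear_combination -2 * h + h1 - h2)

/-- When all four blocks are one-term and `s = k`, the mixed equation `A x ∘ₖ B y + β τ(C x ∘ₖ D y) =
L (x * y)` fails: its left side has a term at distance `2k`, which the other summand could cancel
only if `t` were both `2k` and `-2k`. -/
theorem Monomial.cross_ne_zero {k t : ZMod m} (hk2 : 2 * k ≠ 0) (hk4 : 4 * k ≠ 0) {β : K}
    {a b c d : ZMod m → K} {i j : ZMod m} (ha : Monomial a i) (hd : Monomial d i)
    (hb : Monomial b j) (hc : Monomial c j) (hij : j = i + k ∨ i = j + k)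
    (H : ∀ u v, u ≠ v → circCoeff Φ k a b u v + β * twist Φ t (circCoeff Φ k c d) u v = 0) :
    False := by
  rcases hij with rfl | rfl
  · have h := H i (i + 2 * k) (fun e => hk2 (by linear_combination -e))
    have h1 : a (i - k) = 0 := by
      by_contra h; exact hk2 (by linear_combination -2 * (ha _).1 h)
    have h2 : c (i - t - k) * d (i + 2 * k - t) = 0 := by
      by_contra h
      rw [← ne_eq, mul_ne_zero_iff, hc, hd] at h
      exact hk4 (by linear_combination h.2 - h.1)
    have h3 : c (i - t) * d (i + 2 * k - t - k) = 0 := by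
      by_contra h
      rw [← ne_eq, mul_ne_zero_iff, hc, hd] at h
      exact hk2 (by linear_combination h.2 - h.1)
    have h4 : a i * b (i + 2 * k - k) ≠ 0 := by
      rw [mul_ne_zero_iff, ha, hb]; exact ⟨rfl, by ring⟩
    simp only [mul_eq_zero] at h2 h3
    simp only [mul_ne_zero_iff] at h4
    rcases h2 with h2 | h2 <;> rcases h3 with h3 | h3 <;>
      simp [circCoeff, twist, h1, h2, h3, h4] at h
  · have h := H (j + 2 * k) j (fun e => hk2 (by linear_combination e))
    have h1 : a (j + 2 * k) = 0 := by
      by_contra h; exact hk2 (by linear_combination 2 * (ha _).1 h)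
    have h2 : c (j + 2 * k - t - k) * d (j - t) = 0 := by
      by_contra h
      rw [← ne_eq, mul_ne_zero_iff, hc, hd] at h
      exact hk2 (by linear_combination h.1 - h.2)
    have h3 : c (j + 2 * k - t) * d (j - t - k) = 0 := by
      by_contra h
      rw [← ne_eq, mul_ne_zero_iff, hc, hd] at h
      exact hk4 (by linear_combination h.1 - h.2)
    have h4 : a (j + 2 * k - k) * b j ≠ 0 := by
      rw [mul_ne_zero_iff, ha, hb]; exact ⟨by ring, rfl⟩
    simp only [mul_eq_zero] at h2 h3
    simp only [mul_ne_zero_iff] at h4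
    rcases h2 with h2 | h2 <;> rcases h3 with h3 | h3 <;>
      simp [circCoeff, twist, h1, h2, h3, h4] at h

/-- The combinatorial heart of the argument. `E1`, `E2`, `E3` compare the second components of an
isotopism with blocks `a, b, c, d`, and `F1`, `F2`, `F3` the first ones, on the pairs
`((x, 0), (y, 0))`, `((0, x), (0, y))` and `((x, 0), (0, y))`. -/
theorem params_eq_of_coeff (h2 : (2 : K) ≠ 0) {k s r t : ZMod m} (hk2 : 2 * k ≠ 0)
    (hk4 : 4 * k ≠ 0) (hs2 : 2 * s ≠ 0) (hks : k = -s → k = s) (hrt : t = -r → t = r) {α β : K}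
    (hα : α ≠ 0) (hβ : β ≠ 0) {a b c d l l₃ l₃' : ZMod m → K}
    (hab : a = 0 → b ≠ 0) (hcd : c = 0 → d ≠ 0) (hac : a = 0 → c ≠ 0) (hbd : b = 0 → d ≠ 0)
    (E1 : ∀ i j, a i * c j + c i * a j = linkCoeff k l₃ i j)
    (E2 : ∀ i j, b i * d j + d i * b j = linkCoeff k l₃' i j)
    (E3 : ∀ i j, i ≠ j → a i * d j + c i * b j = 0)
    (F1 : ∀ u v, circCoeff Φ s a a u v + β * twist Φ t (circCoeff Φ s c c) u v
      = linkCoeff k l u v)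
    (F2 : ∀ u v, circCoeff Φ s b b u v + β * twist Φ t (circCoeff Φ s d d) u v
      = linkCoeff k (fun n => Φ (n - r) α * l (n - r)) u v)
    (F3 : ∀ u v, u ≠ v → circCoeff Φ s a b u v + β * twist Φ t (circCoeff Φ s c d) u v = 0) :
    k = s ∧ t = r := by
  have hα' (n : ZMod m) : Φ (n - r) α ≠ 0 := by simpa using hα
  have S1 {i j : ZMod m} := adjacent_of_orthogonal h2 hk2 E1 (i := i) (j := j)
  have S2 {i j : ZMod m} := adjacent_of_orthogonal h2 hk2 E2 (i := i) (j := j)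
  have hk0 : k ≠ 0 := by rintro rfl; simp at hk2
  -- An index of `A` and a different index of `D` would need `C` and `A` to share an index.
  have S3 (i j : ZMod m) (hi : a i ≠ 0) (hj : d j ≠ 0) : i = j := by
    by_contra hne
    have hc : c i ≠ 0 := fun hc => by
      have := E3 i j hne
      rw [hc, zero_mul, add_zero] at this
      exact mul_ne_zero hi hj this
    have := S1 hi hc
    simp [hk0] at this
  have S4 (i j : ZMod m) (hi : c i ≠ 0) (hj : b j ≠ 0) : i = j := by
    by_contra hne
    have ha : a i ≠ 0 := fun ha => by
      have := E3 i j hne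
      rw [ha, zero_mul, zero_add] at this
      exact mul_ne_zero hi hj this
    have := S1 ha hi
    simp [hk0] at this
  have hks' : k = s ∨ k = -s → k = s := fun h => h.elim id hks
  have G1 := step_add_twist_step F1
  have G2 := step_add_twist_step F2
  -- If a block vanishes, its two neighbours are one-term at the same index and the opposite block
  -- has at most one term; comparing indices gives `t = r` or `t = -r`.
  by_cases hc : c = 0
  · obtain ⟨i, ha, hd⟩ := exists_monomial (fun h => hac h hc) (hcd hc) S3
    subst hc
    obtain rfl := hks' (param_eq_of_left hs2 ha F1)
    obtain ⟨j, hb⟩ := exists_subMonomial_left h2 hk2 hk4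
      (fun n hn => (S2 hn ((hd i).2 rfl)).symm) hd.sub F2
    refine ⟨rfl, ?_⟩
    simp only [linkCoeff_step hk2] at G1 G2
    have hl : Monomial l i := by
      have : l = fun n => circCoeff Φ k a a (n + k) n := by
        funext n; rw [← G1]; simp [circCoeff]
      exact this ▸ ha.step hk2
    have := (hb.step hk2).eq_of_add ((hd.step hk2).shift hβ) (hl.scale hα') G2
    linear_combination this
  by_cases hb : b = 0
  · obtain ⟨i, ha, hd⟩ := exists_monomial (fun h => hab h hb) (hbd hb) S3
    subst hb
    obtain rfl := hks' (param_eq_of_right hβ hs2 hd F2)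
    obtain ⟨j, hc⟩ := exists_subMonomial_right h2 hk2 hk4 hβ
      (fun n hn => (S1 ((ha i).2 rfl) hn)) ha.sub F1
    refine ⟨rfl, ?_⟩
    simp only [linkCoeff_step hk2] at G1 G2
    have hl : Monomial l (i + t - r) := by
      refine Monomial.of_scale hα' ?_
      have : (fun n => Φ (n - r) α * l (n - r)) =
          fun n => β * Φ t (circCoeff Φ k d d (n - t + k) (n - t)) := by
        funext n; rw [← G2]; simp [circCoeff]
      exact this ▸ (hd.step hk2).shift hβ
    have := ((hc.step hk2).shift (e := β) (t := t)).eq_of_add (ha.step hk2) hl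
      fun u => by rw [← G1, add_comm]
    linear_combination -this
  obtain ⟨j, hcm, hbm⟩ := exists_monomial hc hb S4
  by_cases ha : a = 0
  · subst ha
    obtain rfl := hks' (param_eq_of_right hβ hs2 hcm F1)
    obtain ⟨n, hd⟩ := exists_subMonomial_right h2 hk2 hk4 hβ
      (fun n hn => (S2 ((hbm j).2 rfl) hn)) hbm.sub F2
    refine ⟨rfl, hrt ?_⟩
    simp only [linkCoeff_step hk2] at G1 G2
    have hl : Monomial l (j + t) := by
      have : l = fun n => β * Φ t (circCoeff Φ k c c (n - t + k) (n - t)) := by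
        funext n; rw [← G1]; simp [circCoeff]
      exact this ▸ (hcm.step hk2).shift hβ
    have := ((hd.step hk2).shift (e := β) (t := t)).eq_of_add (hbm.step hk2) (hl.scale hα')
      fun u => by rw [← G2, add_comm]
    linear_combination -this
  by_cases hd : d = 0
  · subst hd
    obtain rfl := hks' (param_eq_of_left hs2 hbm F2)
    obtain ⟨n, ha⟩ := exists_subMonomial_left h2 hk2 hk4
      (fun n hn => (S1 hn ((hcm j).2 rfl)).symm) hcm.sub F1
    refine ⟨rfl, hrt ?_⟩
    simp only [linkCoeff_step hk2] at G1 G2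
    have hl : Monomial l (j - r) := by
      refine Monomial.of_scale hα' ?_
      have : (fun n => Φ (n - r) α * l (n - r)) = fun n => circCoeff Φ k b b (n + k) n := by
        funext n; rw [← G2]; simp [circCoeff]
      exact this ▸ hbm.step hk2
    have := (ha.step hk2).eq_of_add ((hcm.step hk2).shift hβ) hl G1
    linear_combination this
  exfalso
  -- No block vanishes: all four are one-term, and the equations contradict each other.
  obtain ⟨i, ham, hdm⟩ := exists_monomial ha hd S3
  have hij := S1 ((ham i).2 rfl) ((hcm j).2 rfl)
  by_cases hne : k = s ∨ k = -s
  · obtain rfl := hks' hne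
    exact ham.cross_ne_zero hk2 hk4 hdm hbm hcm hij F3
  · push Not at hne
    have h0 (l : ZMod m → K) (n : ZMod m) : linkCoeff k l (n + s) n = 0 :=
      linkCoeff_eq_zero (fun e => hne.1 (by linear_combination -e))
        (fun e => hne.2 (by linear_combination -e))
    exact ham.add_twist_ne_zero hk2 hs2 hβ hdm hbm hcm hij (fun n => (G1 n).trans (h0 _ n))
      fun n => (G2 n).trans (h0 _ n)

end Core

/-! ### Linearized polynomials over a finite field -/

section LinearizedPolynomial

variable {m : ℕ} {K : Type*} [Field K]

/-- The powers of Frobenius, indexed by `ZMod m`, form a `K`-basis of the `F_p`-linear maps `K → K`: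
they are independent by Dedekind's theorem, and there are as many as the dimension. -/
theorem exists_frobenius_family {p : ℕ} [Fact p.Prime] [Finite K] [Algebra (ZMod p) K]
    [NeZero m] (hK : Nat.card K = p ^ m) :
    ∃ Φ : ZMod m → K →+* K, (∀ (n : ℕ) (x : K), Φ n x = x ^ p ^ n) ∧
      (∀ i j x, Φ (i + j) x = Φ i (Φ j x)) ∧
      LinearIndependent K (fun i => (Φ i : K → K)) ∧
      ∀ f : K →ₗ[ZMod p] K, ∃ a : ZMod m → K, ∀ x, f x = ∑ i, a i * Φ i x := by
  have hfin : Module.finrank (ZMod p) K = m := by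
    have h := Module.natCard_eq_pow_finrank (K := ZMod p) (V := K)
    rw [hK, Nat.card_zmod] at h
    exact (Nat.pow_right_injective (Fact.out : p.Prime).two_le h).symm
  let F := FiniteField.frobeniusAlgHom (ZMod p) K
  have hord : orderOf F = m := (FiniteField.orderOf_frobeniusAlgHom (ZMod p) K).trans hfin
  have hmod (n : ℕ) : F ^ (n : ZMod m).val = F ^ n := by
    rw [ZMod.val_natCast, ← hord, pow_mod_orderOf]
  have hpow (n : ℕ) (x : K) : (F ^ n) x = x ^ p ^ n := by
    induction n with
    | zero => simp
    | succ n ih =>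
      rw [pow_succ', AlgHom.mul_apply, ih, FiniteField.coe_frobeniusAlgHom, ZMod.card, pow_succ,
        pow_mul]
  have hinj : Function.Injective fun i : ZMod m => F ^ i.val := by
    intro i j hij
    have := pow_injOn_Iio_orderOf (x := F) (hord ▸ ZMod.val_lt i) (hord ▸ ZMod.val_lt j) hij
    exact ZMod.val_injective m this
  have hli : LinearIndependent K fun i : ZMod m => (F ^ i.val).toLinearMap :=
    (linearIndependent_toLinearMap (ZMod p) K K).comp _ hinj
  refine ⟨fun i => (F ^ i.val : K →ₐ[ZMod p] K), fun n x => ?_, fun i j x => ?_, ?_, fun f => ?_⟩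
  · simp only [hmod]
    exact hpow n x
  · have : F ^ (i + j).val = F ^ i.val * F ^ j.val := by
      rw [← pow_add, ← hmod (i.val + j.val)]
      simp
    simp only [this]
    rfl
  · exact (linearIndependent_monoidHom K K).comp
      (fun i : ZMod m => ((F ^ i.val : K →ₐ[ZMod p] K) : K →* K))
      fun i j hij => hinj (AlgHom.ext fun x => DFunLike.congr_fun hij x)
  · have hspan := hli.span_eq_top_of_card_eq_finrank
      (by rw [ZMod.card, Module.finrank_linearMap_self, hfin])
    obtain ⟨a, ha⟩ := (Submodule.mem_span_range_iff_exists_fun K).1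
      (hspan ▸ Submodule.mem_top : f ∈ _)
    exact ⟨a, fun x => by rw [← ha]; simp⟩

variable [NeZero m] (Φ : ZMod m → K →+* K)

/-- The linearized polynomial `∑ aᵢ Φ i` as a function. -/
def linPoly (a : ZMod m → K) (x : K) : K := ∑ i, a i * Φ i x

/-- The bilinear expression `∑ q i j * Φ i x * Φ j y`. -/
def bilinPoly (q : ZMod m → ZMod m → K) (x y : K) : K := ∑ i, ∑ j, q i j * (Φ i x * Φ j y)

variable {Φ}

@[simp] theorem linPoly_zero (x : K) : linPoly Φ 0 x = 0 := by simp [linPoly]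

/-- The coefficients of a bilinear expression are determined by its values. -/
theorem bilinPoly_injective (hli : LinearIndependent K (fun i => (Φ i : K → K)))
    {q q' : ZMod m → ZMod m → K} (h : ∀ x y, bilinPoly Φ q x y = bilinPoly Φ q' x y)
    (i j : ZMod m) : q i j = q' i j := by
  have key {a : ZMod m → K} (ha : ∀ x, ∑ i, a i * Φ i x = 0) (i : ZMod m) : a i = 0 :=
    Fintype.linearIndependent_iff.1 hli a (by ext x; simpa using ha x) i
  rw [← sub_eq_zero]
  refine key (a := fun j => q i j - q' i j) (fun y => ?_) j
  refine key (a := fun i => ∑ j, (q i j - q' i j) * Φ j y) (fun x => ?_) i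
  rw [← sub_eq_zero.2 (h x y), bilinPoly, bilinPoly, ← Finset.sum_sub_distrib]
  refine Finset.sum_congr rfl fun i _ => ?_
  rw [← Finset.sum_sub_distrib, Finset.sum_mul]
  exact Finset.sum_congr rfl fun j _ => by ring

theorem bilinPoly_add (q q' : ZMod m → ZMod m → K) (x y : K) :
    bilinPoly Φ q x y + bilinPoly Φ q' x y = bilinPoly Φ (fun i j => q i j + q' i j) x y := by
  simp only [bilinPoly, ← Finset.sum_add_distrib, add_mul]

theorem mul_bilinPoly (β : K) (q : ZMod m → ZMod m → K) (x y : K) :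
    β * bilinPoly Φ q x y = bilinPoly Φ (fun i j => β * q i j) x y := by
  simp only [bilinPoly, Finset.mul_sum, mul_assoc]

theorem linPoly_mul_linPoly (a b : ZMod m → K) (x y : K) :
    linPoly Φ a x * linPoly Φ b y = bilinPoly Φ (fun i j => a i * b j) x y := by
  rw [linPoly, linPoly, Finset.sum_mul_sum]
  exact Finset.sum_congr rfl fun i _ => Finset.sum_congr rfl fun j _ => by ring

theorem map_linPoly (hadd : ∀ i j x, Φ (i + j) x = Φ i (Φ j x)) (s : ZMod m) (a : ZMod m → K)
    (x : K) : Φ s (linPoly Φ a x) = linPoly Φ (fun i => Φ s (a (i - s))) x := by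
  rw [linPoly, linPoly, map_sum]
  refine Fintype.sum_equiv (Equiv.addRight s) _ _ fun i => ?_
  simp only [Equiv.coe_addRight, add_sub_cancel_right]
  rw [add_comm i s, hadd, map_mul]

theorem map_bilinPoly (hadd : ∀ i j x, Φ (i + j) x = Φ i (Φ j x)) (t : ZMod m)
    (q : ZMod m → ZMod m → K) (x y : K) :
    Φ t (bilinPoly Φ q x y) = bilinPoly Φ (twist Φ t q) x y := by
  rw [bilinPoly, bilinPoly, map_sum]
  refine Fintype.sum_equiv (Equiv.addRight t) _ _ fun i => ?_
  rw [map_sum]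
  refine Fintype.sum_equiv (Equiv.addRight t) _ _ fun j => ?_
  simp only [Equiv.coe_addRight, twist, add_sub_cancel_right]
  rw [add_comm i t, add_comm j t, hadd, hadd, map_mul, map_mul]

theorem map_mul_add_map_mul_linPoly (hadd : ∀ i j x, Φ (i + j) x = Φ i (Φ j x)) (s : ZMod m)
    (a b : ZMod m → K) (x y : K) :
    Φ s (linPoly Φ a x) * linPoly Φ b y + Φ s (linPoly Φ b y) * linPoly Φ a x
      = bilinPoly Φ (circCoeff Φ s a b) x y := by
  rw [map_linPoly hadd, map_linPoly hadd, mul_comm (linPoly Φ _ y), linPoly_mul_linPoly,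
    linPoly_mul_linPoly, bilinPoly_add]
  rfl

theorem linPoly_mul (l : ZMod m → K)
    (x y : K) :
    linPoly Φ l (x * y) = bilinPoly Φ (fun i j => if i = j then l i else 0) x y := by
  simp [linPoly, bilinPoly]

theorem linPoly_circ (hadd : ∀ i j x, Φ (i + j) x = Φ i (Φ j x)) (k : ZMod m) (l : ZMod m → K)
    (x y : K) :
    linPoly Φ l (Φ k x * y + Φ k y * x) = bilinPoly Φ (linkCoeff k l) x y := by
  simp only [linPoly, bilinPoly, linkCoeff, add_mul, Finset.sum_add_distrib, ite_mul, zero_mul]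
  rw [Finset.sum_comm]
  simp only [Finset.sum_ite_eq', Finset.mem_univ, if_true, map_add, map_mul,
    mul_add, Finset.sum_add_distrib, hadd]
  congr 1
  exact Finset.sum_congr rfl fun i _ => by ring

theorem linPoly_mul_map (hadd : ∀ i j x, Φ (i + j) x = Φ i (Φ j x)) (r : ZMod m) (α : K)
    (l : ZMod m → K) (z : K) :
    linPoly Φ l (α * Φ r z) = linPoly Φ (fun n => Φ (n - r) α * l (n - r)) z := by
  rw [linPoly, linPoly]
  refine Fintype.sum_equiv (Equiv.addRight r) _ _ fun i => ?_
  rw [Equiv.coe_addRight, add_sub_cancel_right, hadd, map_mul]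
  ring

end LinearizedPolynomial

/-! ### From isotopisms to coefficient equations -/

section Reduction

/-- Polarization: in odd characteristic a commutative biadditive multiplication is recovered from its
square map. -/
theorem LinearlyEquivalent.stronglyIsotopic {p : ℕ} [Fact p.Prime] (hp : p ≠ 2) {V : Type*}
    [AddCommGroup V] [Module (ZMod p) V] {mul₁ mul₂ : V → V → V}
    (hc₁ : ∀ x y, mul₁ x y = mul₁ y x) (ha₁ : ∀ x y z, mul₁ (x + y) z = mul₁ x z + mul₁ y z)
    (hc₂ : ∀ x y, mul₂ x y = mul₂ y x) (ha₂ : ∀ x y z, mul₂ (x + y) z = mul₂ x z + mul₂ y z)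
    (h : LinearlyEquivalent p (squareMap mul₁) (squareMap mul₂)) :
    StronglyIsotopic p mul₁ mul₂ := by
  obtain ⟨l₁, l₂, h⟩ := h
  have hpol {mul : V → V → V} (hc : ∀ x y, mul x y = mul y x)
      (ha : ∀ x y z, mul (x + y) z = mul x z + mul y z) (x y : V) :
      squareMap mul (x + y) = squareMap mul x + squareMap mul y + (2 : ZMod p) • mul x y := by
    simp only [squareMap, ha]
    rw [hc x (x + y), hc y (x + y), ha, ha, hc y x, two_smul]
    abel
  have h2 : (2 : ZMod p) ≠ 0 := by
    have : ringChar (ZMod p) ≠ 2 := by rwa [ZMod.ringChar_zmod_n]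
    exact Ring.two_ne_zero this
  have hsq (x : V) : squareMap mul₂ (l₂.symm x) = l₁ (squareMap mul₁ x) := by simp [h]
  refine ⟨l₂.symm, l₁, fun x y => ?_⟩
  have key := hsq (x + y)
  rw [map_add, hpol hc₂ ha₂, hpol hc₁ ha₁, hsq, hsq, map_add, map_add, map_smul] at key
  exact smul_right_injective V h2 (add_left_cancel key)

variable {K : Type*} [Field K]

theorem pmul_comm (p k : ℕ) (σ : K ≃+* K) (α : K) (x y : K × K) :
    pmul p k σ α x y = pmul p k σ α y x := by
  simp only [pmul, circ, Prod.mk.injEq]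
  constructor
  · rw [add_comm (x.1 ^ _ * _), add_comm (x.2 ^ _ * _)]
  · ring

theorem pmul_add_left (p : ℕ) [ExpChar K p] (k : ℕ) (σ : K ≃+* K) (α : K) (x y z : K × K) :
    pmul p k σ α (x + y) z = pmul p k σ α x z + pmul p k σ α y z := by
  simp only [pmul, circ, Prod.fst_add, Prod.snd_add, add_pow_expChar_pow, Prod.mk_add_mk,
    Prod.mk.injEq, map_add, map_mul]
  constructor <;> ring

theorem dvd_of_dvd_four_mul {m k : ℕ} (hm : 0 < m) (h : Odd (m / Nat.gcd m k)) (h4 : m ∣ 4 * k) :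
    m ∣ k := by
  have hg : 0 < Nat.gcd m k := Nat.gcd_pos_of_pos_left k hm
  have hcop : Nat.Coprime (m / Nat.gcd m k) (k / Nat.gcd m k) := Nat.coprime_div_gcd_div_gcd hg
  have h1 : m / Nat.gcd m k ∣ 4 * (k / Nat.gcd m k) := by
    rw [← Nat.mul_div_assoc _ (Nat.gcd_dvd_right m k)]
    exact Nat.div_dvd_div (Nat.gcd_dvd_left m k) h4
  have h3 : Nat.Coprime (m / Nat.gcd m k) 4 := by
    rw [show 4 = 2 ^ 2 by norm_num]
    exact (Nat.coprime_two_right.2 h).pow_right 2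
  have h5 := Nat.dvd_one.1 (hcop ▸ Nat.dvd_gcd dvd_rfl (h3.dvd_of_dvd_mul_left h1))
  have h6 : m = Nat.gcd m k := by
    rw [← Nat.div_mul_cancel (Nat.gcd_dvd_left m k), h5, one_mul]
    simp
  rw [h6]
  exact Nat.gcd_dvd_right m k

theorem eq_of_natCast_eq_neg {m i j : ℕ} (hi : i ≤ m / 2) (hj : j ≤ m / 2)
    (h : (i : ZMod m) = -j) : i = j := by
  have h0 : ((i + j : ℕ) : ZMod m) = 0 := by push_cast; rw [h]; ring
  obtain ⟨c, hc⟩ := (ZMod.natCast_eq_zero_iff _ _).1 h0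
  rcases Nat.lt_or_ge c 1 with h1 | h1
  · obtain rfl : c = 0 := by omega
    omega
  · have := Nat.mul_le_mul_left m h1
    omega

theorem eq_of_natCast_eq {m i j : ℕ} (hm : 0 < m) (hi : i ≤ m / 2) (hj : j ≤ m / 2)
    (h : (i : ZMod m) = j) : i = j :=
  Nat.ModEq.eq_of_lt_of_lt ((ZMod.natCast_eq_natCast_iff _ _ _).1 h) (by omega) (by omega)

/-- A strong isotopism between two presemifields of the family forces equal parameters; of `α` and
`β` only non-vanishing matters. -/
theorem StronglyIsotopic.params_eq {p m : ℕ} [Fact p.Prime] (hp : p ≠ 2) [Finite K]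
    [Algebra (ZMod p) K] (hK : Nat.card K = p ^ m) {k s r t : ℕ}
    (hk : 0 < k) (hk' : k ≤ m / 2) (hs : 0 < s) (hs' : s ≤ m / 2)
    (hr : r ≤ m / 2) (ht : t ≤ m / 2)
    (hkm : Odd (m / Nat.gcd m k)) (hsm : Odd (m / Nat.gcd m s))
    {σ τ : K ≃+* K} (hσ : ∀ x : K, σ x = x ^ p ^ r) (hτ : ∀ x : K, τ x = x ^ p ^ t)
    {α β : K} (hα : α ≠ 0) (hβ : β ≠ 0)
    (h : StronglyIsotopic p (pmul p k σ α) (pmul p s τ β)) : k = s ∧ t = r := by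
  have hm : 0 < m := by omega
  have : NeZero m := ⟨hm.ne'⟩
  obtain ⟨Φ, hΦ, hadd, hli, hspan⟩ := exists_frobenius_family hK
  obtain ⟨N, L, h⟩ := h
  have blocks (M : (K × K) →ₗ[ZMod p] K × K) : ∃ a b c d : ZMod m → K, ∀ x y,
      M (x, y) = (linPoly Φ a x + linPoly Φ b y, linPoly Φ c x + linPoly Φ d y) := by
    obtain ⟨a, ha⟩ := hspan (LinearMap.fst _ _ _ ∘ₗ M ∘ₗ LinearMap.inl _ _ _)
    obtain ⟨b, hb⟩ := hspan (LinearMap.fst _ _ _ ∘ₗ M ∘ₗ LinearMap.inr _ _ _)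
    obtain ⟨c, hc⟩ := hspan (LinearMap.snd _ _ _ ∘ₗ M ∘ₗ LinearMap.inl _ _ _)
    obtain ⟨d, hd⟩ := hspan (LinearMap.snd _ _ _ ∘ₗ M ∘ₗ LinearMap.inr _ _ _)
    refine ⟨a, b, c, d, fun x y => ?_⟩
    have hxy : ((x, y) : K × K) = (x, 0) + (0, y) := by simp
    simp only [LinearMap.comp_apply, LinearMap.inl_apply, LinearMap.inr_apply,
      LinearMap.fst_apply, LinearMap.snd_apply] at ha hb hc hd
    rw [hxy, map_add]
    ext
    · simp only [Prod.fst_add, ha, hb, linPoly]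
    · simp only [Prod.snd_add, hc, hd, linPoly]
  obtain ⟨a, b, c, d, hN⟩ := blocks N
  obtain ⟨l₁, l₂, l₃, l₄, hL⟩ := blocks L
  simp only [LinearEquiv.coe_coe] at hN hL
  have hcirc (n : ℕ) (x y : K) : circ p n x y = Φ n x * y + Φ n y * x := by
    rw [circ, hΦ, hΦ]
  have hσ' (x : K) : σ x = Φ r x := by rw [hσ, hΦ]
  have hτ' (x : K) : τ x = Φ t x := by rw [hτ, hΦ]
  have lin0 (l : ZMod m → K) : linPoly Φ l 0 = 0 := by simp [linPoly]
  -- The isotopism identity on pairs of coordinate vectors, expanded into bilinear expressions.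
  have hxx (x y : K) := h (x, 0) (y, 0)
  have hyy (x y : K) := h (0, x) (0, y)
  have hxy (x y : K) := h (x, 0) (0, y)
  simp only [pmul, hN, hL, hcirc, hσ', hτ', lin0, map_zero, mul_zero, zero_mul, add_zero, zero_add,
    linPoly_mul_map hadd, linPoly_mul, linPoly_circ hadd, linPoly_mul_linPoly,
    map_mul_add_map_mul_linPoly hadd, map_bilinPoly hadd, mul_bilinPoly, bilinPoly_add,
    Prod.mk.injEq, forall_and] at hxx hyy hxy
  have two : (2 : K) ≠ 0 := by
    have : CharP K p := charP_of_injective_algebraMap (algebraMap (ZMod p) K).injective p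
    exact Ring.two_ne_zero (by rwa [ringChar.eq K p])
  have cast_ne {n : ℕ} (hn : 0 < n) (hn' : n ≤ m / 2) (hodd : Odd (m / Nat.gcd m n)) :
      (4 : ZMod m) * n ≠ 0 := fun h0 => by
    have h4 : ((4 * n : ℕ) : ZMod m) = 0 := by exact_mod_cast h0
    have := Nat.le_of_dvd hn
      (dvd_of_dvd_four_mul hm hodd ((ZMod.natCast_eq_zero_iff _ _).1 h4))
    omega
  have hk4 := cast_ne hk hk' hkm
  have hs4 := cast_ne hs hs' hsm
  have hinj : ∀ x y, N (x, y) = 0 → x = 0 ∧ y = 0 := fun x y hx => by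
    simpa using hx
  have hsurj (z : K × K) : ∃ x y, N (x, y) = z := by
    obtain ⟨⟨x, y⟩, hx⟩ := N.surjective z
    exact ⟨x, y, hx⟩
  obtain ⟨h1, h2⟩ := params_eq_of_coeff (Φ := Φ) two (k := k) (s := s) (r := r) (t := t)
    (fun h => hk4 (by linear_combination 2 * h)) hk4 (fun h => hs4 (by linear_combination 2 * h))
    (fun h => by rw [eq_of_natCast_eq_neg hk' hs' h])
    (fun h => by rw [eq_of_natCast_eq_neg ht hr h]) hα hβ
    (a := a) (b := b) (c := c) (d := d)
    (by
      rintro rfl rfl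
      obtain ⟨x, y, hx⟩ := hsurj (1, 0)
      simp [hN] at hx)
    (by
      rintro rfl rfl
      obtain ⟨x, y, hx⟩ := hsurj (0, 1)
      simp [hN] at hx)
    (by
      rintro rfl rfl
      simpa using (hinj 1 0 (by simp [hN, lin0])).1)
    (by
      rintro rfl rfl
      simpa using (hinj 0 1 (by simp [hN, lin0])).2)
    (bilinPoly_injective hli hxx.2) (bilinPoly_injective hli hyy.2)
    (fun i j hij => (bilinPoly_injective hli hxy.2 i j).trans (if_neg hij))
    (bilinPoly_injective hli hxx.1) (bilinPoly_injective hli hyy.1)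
    (fun i j hij => (bilinPoly_injective hli hxy.1 i j).trans (if_neg hij))
  exact ⟨eq_of_natCast_eq hm hk' hs' h1, eq_of_natCast_eq hm ht hr h2⟩

end Reduction

end TwoParam

theorem mainTheorem4 {p m : ℕ} [Fact p.Prime] (hp : p ≠ 2)
    {K : Type*} [Field K] [Finite K] [Algebra (ZMod p) K] (hK : Nat.card K = p ^ m)
    (k s r t : ℕ)
    (hk : 0 < k) (hk' : k ≤ m / 2) (hs : 0 < s) (hs' : s ≤ m / 2)
    (hr : r ≤ m / 2) (ht : t ≤ m / 2)
    (hkm : Odd (m / Nat.gcd m k)) (hsm : Odd (m / Nat.gcd m s))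
    (σ τ : K ≃+* K) (hσ : ∀ x : K, σ x = x ^ p ^ r) (hτ : ∀ x : K, τ x = x ^ p ^ t)
    (α β : K) (hα : ¬ IsSquare α) (hβ : ¬ IsSquare β)
    (hne : (k, σ) ≠ (s, τ)) :
    ¬ TwoParam.StronglyIsotopic p (TwoParam.pmul p k σ α) (TwoParam.pmul p s τ β) ∧
      ¬ TwoParam.LinearlyEquivalent p
        (TwoParam.squareMap (TwoParam.pmul p k σ α))
        (TwoParam.squareMap (TwoParam.pmul p s τ β)) := by
  have hα₀ : α ≠ 0 := by rintro rfl; exact hα .zero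
  have hβ₀ : β ≠ 0 := by rintro rfl; exact hβ .zero
  have hiso : ¬ TwoParam.StronglyIsotopic p (TwoParam.pmul p k σ α) (TwoParam.pmul p s τ β) := by
    intro h
    obtain ⟨rfl, rfl⟩ := h.params_eq hp hK hk hk' hs hs' hr ht hkm hsm hσ hτ hα₀ hβ₀
    exact hne (by rw [show σ = τ from RingEquiv.ext fun x => by rw [hσ, hτ]])
  have : CharP K p := charP_of_injective_algebraMap (algebraMap (ZMod p) K).injective p
  have : ExpChar K p := ExpChar.prime Fact.out
  exact ⟨hiso, fun h => hiso (h.stronglyIsotopic hp (TwoParam.pmul_comm p k σ α)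
    (TwoParam.pmul_add_left p k σ α) (TwoParam.pmul_comm p s τ β)
    (TwoParam.pmul_add_left p s τ β))⟩
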